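/- Let $S=\mathbb{C}[x_0,\ldots,x_n]$ with $n\ge 0$. For a form (homogeneous polynomial) $F\in S$ of degree $d$, the Waring rank $\mathrm{rk}_{\mathbb C}F$ is the least integer $r$ such that $F=\sum_{j=1}^r\lambda_jL_j^{d}$ for some linear forms $L_1,\ldots,L_r\in S$ and some $\lambda_1,\ldots,\lambda_r\in\mathbb C$. Let $M_1=x_0^{c}x_1^{a_1}\cdots x_n^{a_n}$ and $M_2=x_0^{c}x_1^{b_1}\cdots x_n^{b_n}$ be monomials of the same degree, where $1\le c\le a_i$ and $1\le c\le b_i$ for $i=1,\ldots,n$. Suppose that for every $i=1,\ldots,n$ one has $|a_i-b_i|\in\{0,1\}$ or $|a_i-b_i|\ge c+1$. Let $M_{12}=\gcd(M_1,M_2)$. Then $$\mathrm{rk}_{\mathbb C}(M_1+M_2)\le \mathrm{rk}_{\mathbb C}M_1+\mathrm{rk}_{\mathbb C}M_2-\mathrm{rk}_{\mathbb C}M_{12}.$$ -/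

import Mathlib

open MvPolynomial

/-- `F` is a linear combination of the `d`-th powers of `r` linear forms, where `d = deg F`. -/
def HasWaringDecomposition {m : ℕ} (F : MvPolynomial (Fin m) ℂ) (r : ℕ) : Prop :=
  ∃ (lam : Fin r → ℂ) (L : Fin r → MvPolynomial (Fin m) ℂ),
    (∀ j, (L j).IsHomogeneous 1) ∧ F = ∑ j, C (lam j) * L j ^ F.totalDegree

/-- The complex Waring rank: the least number of linear forms in a Waring decomposition of `F`.
By `hasWaringDecomposition_of_isHomogeneous` the minimum is attained for every form `F`. -/
noncomputable def waringRank {m : ℕ} (F : MvPolynomial (Fin m) ℂ) : ℕ :=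
  sInf {r : ℕ | HasWaringDecomposition F r}

/-- The span of the `d`-th powers of the linear forms. -/
noncomputable def powerSpan (m d : ℕ) : Submodule ℂ (MvPolynomial (Fin m) ℂ) :=
  Submodule.span ℂ {P | ∃ L : MvPolynomial (Fin m) ℂ, L.IsHomogeneous 1 ∧ P = L ^ d}

theorem mul_pow_mem_powerSpan {m : ℕ} (d : ℕ) (L M : MvPolynomial (Fin m) ℂ)
    (hL : L.IsHomogeneous 1) (hM : M.IsHomogeneous 1) :
    L * M ^ d ∈ powerSpan m (d + 1) := by
  by_contra hn
  obtain ⟨f, hf, hker⟩ := Submodule.exists_le_ker_of_notMem hn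
  let p : Polynomial ℂ := ∑ k ∈ Finset.range (d + 1 + 1),
    Polynomial.C (((d + 1).choose k : ℂ) * f (L ^ k * M ^ (d + 1 - k))) * Polynomial.X ^ k
  have hp : p = 0 := by
    apply Polynomial.funext
    intro t
    have h1 : (C t * L + M) ^ (d + 1) ∈ powerSpan m (d + 1) := by
      refine Submodule.subset_span ⟨_, ?_, rfl⟩
      have := ((isHomogeneous_C (Fin m) t).mul hL).add (by simpa using hM)
      simpa using this
    have h2 := hker h1
    rw [LinearMap.mem_ker, add_pow, map_sum] at h2
    simp only [p, Polynomial.eval_finsetSum, Polynomial.eval_mul, Polynomial.eval_C,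
      Polynomial.eval_pow, Polynomial.eval_X, Polynomial.eval_zero]
    rw [← h2]
    refine Finset.sum_congr rfl fun k _ => ?_
    have : (C t * L) ^ k * M ^ (d + 1 - k) * ((d + 1).choose k : MvPolynomial (Fin m) ℂ)
        = (((d + 1).choose k : ℂ) * t ^ k) • (L ^ k * M ^ (d + 1 - k)) := by
      rw [smul_eq_C_mul, map_mul, map_pow, map_natCast]
      ring
    rw [this, map_smul, smul_eq_mul]
    ring
  have hc : p.coeff 1 = ((d + 1).choose 1 : ℂ) * f (L ^ 1 * M ^ (d + 1 - 1)) := by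
    simp only [p, Polynomial.finsetSum_coeff, Polynomial.coeff_C_mul_X_pow]
    rw [Finset.sum_eq_single 1]
    · simp
    · intro b _ hb
      rw [if_neg (Ne.symm hb)]
    · intro h
      simp at h
  rw [hp] at hc
  simp only [Polynomial.coeff_zero, Nat.choose_one_right, pow_one, Nat.add_sub_cancel] at hc
  rcases mul_eq_zero.mp hc.symm with h | h
  · exact (Nat.cast_ne_zero.mpr (Nat.succ_ne_zero d)) h
  · exact hf h

theorem mul_mem_powerSpan {m : ℕ} (d : ℕ) (L P : MvPolynomial (Fin m) ℂ)
    (hL : L.IsHomogeneous 1) (hP : P ∈ powerSpan m d) : L * P ∈ powerSpan m (d + 1) := by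
  induction hP using Submodule.span_induction with
  | mem x hx =>
    obtain ⟨M, hM, rfl⟩ := hx
    exact mul_pow_mem_powerSpan d L M hL hM
  | zero => simp
  | add x y _ _ hx hy => rw [mul_add]; exact Submodule.add_mem _ hx hy
  | smul a x _ hx => rw [mul_smul_comm]; exact Submodule.smul_mem _ a hx

theorem monomial_mem_powerSpan {m : ℕ} (d : ℕ) :
    ∀ e : Fin m →₀ ℕ, e.degree = d → monomial e (1 : ℂ) ∈ powerSpan m d := by
  induction d with
  | zero =>
    intro e he
    rw [Finsupp.degree_eq_zero_iff] at he
    subst he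
    exact Submodule.subset_span ⟨0, isHomogeneous_zero _ _ _, by simp⟩
  | succ d ih =>
    intro e he
    have hne : e ≠ 0 := by
      rintro rfl
      simp at he
    obtain ⟨i, hi⟩ := Finsupp.ne_iff.mp hne
    have hle : Finsupp.single i 1 ≤ e := by
      rw [Finsupp.single_le_iff]
      exact Nat.one_le_iff_ne_zero.mpr hi
    have hdec : Finsupp.single i 1 + (e - Finsupp.single i 1) = e := add_tsub_cancel_of_le hle
    have hdeg : (e - Finsupp.single i 1).degree = d := by
      have := congrArg Finsupp.degree hdec
      rw [map_add, Finsupp.degree_single, he] at this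
      omega
    have := mul_mem_powerSpan d (X i) _ (isHomogeneous_X ℂ i) (ih _ hdeg)
    rwa [X, monomial_mul, hdec, one_mul] at this

/-- Every form over `ℂ` has a Waring decomposition, so the Waring rank is a genuine minimum. -/
theorem hasWaringDecomposition_of_isHomogeneous {m d : ℕ} (F : MvPolynomial (Fin m) ℂ)
    (hF : F.IsHomogeneous d) : ∃ r, HasWaringDecomposition F r := by
  rcases eq_or_ne F 0 with rfl | h0
  · exact ⟨0, Fin.elim0, Fin.elim0, fun j => j.elim0, by simp⟩
  have hd := hF.totalDegree h0
  have hmem : F ∈ powerSpan m d := by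
    rw [F.as_sum]
    refine Submodule.sum_mem _ fun e he => ?_
    have hdeg : e.degree = d := by
      by_contra hne
      exact (mem_support_iff.mp he) (hF.coeff_eq_zero hne)
    have := Submodule.smul_mem (powerSpan m d) (coeff e F) (monomial_mem_powerSpan d e hdeg)
    rwa [smul_monomial, smul_eq_mul, mul_one] at this
  obtain ⟨r, c, g, hg⟩ := Submodule.mem_span_set'.mp hmem
  choose L hL hLd using fun j => (g j).2
  refine ⟨r, c, L, hL, ?_⟩
  rw [hd, ← hg]
  refine Finset.sum_congr rfl fun j _ => ?_
  rw [smul_eq_C_mul, hLd j]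

/-!
Let `M = x₀ᶜ x₁^{a₁} ⋯ xₙ^{aₙ}` have degree `d`, with `c ≥ 1`. Suppose `M = ∑ⱼ λⱼ Lⱼᵈ` with fewer
than `∏ (aᵢ + 1)` summands. By linear algebra some nonzero polynomial with exponents bounded by
the `aᵢ` vanishes at the dehomogenized points `Lⱼ` with nonzero `x₀`-coordinate. Homogenize it and
multiply by the monomial that moves one of its terms of top degree to `M`: the multiplier is
divisible by `x₀`, so the result is a form of degree `d` that vanishes at every `Lⱼ` and contains
`M`. This contradicts apolarity, which writes the coefficient of `M` as a combination of the
values at `Lⱼ`.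

Conversely, let `Zᵢ` be a set of `aᵢ + 1` numbers on which `z ^ (aᵢ + 1)` is a polynomial of
degree at most `aᵢ - c`. The Lagrange weights of `Zᵢ` sum `z ^ k` to zero for all `k ≤ aᵢ + c`
except `k = aᵢ`. An exponent of degree `d` other than that of `M` differs from it in some
coordinate `i ≥ 1` where it is at most `aᵢ + c`, so the product weights on the grid `∏ Zᵢ`
decompose `M` into `∏ (aᵢ + 1)` powers.

The condition on `|aᵢ - bᵢ|` is what allows the set for the smaller of `aᵢ`, `bᵢ` to be contained
in the set for the larger one. The grids of `M₁` and `M₂` then meet in a grid of `M₁₂`, and their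
union decomposes `M₁ + M₂`.
-/

section LinearForms

variable {R σ : Type*} [CommSemiring R] [Fintype σ]

/-- The linear form with coefficient vector `l`, so that forms can be evaluated at linear forms. -/
noncomputable def linearForm (l : σ → R) : MvPolynomial σ R :=
  ∑ i, l i • X i

theorem isHomogeneous_linearForm (l : σ → R) : (linearForm l).IsHomogeneous 1 :=
  IsHomogeneous.sum _ _ _ fun i _ => by
    rw [smul_eq_C_mul]
    exact isHomogeneous_C_mul_X _ _

theorem exists_linearForm_eq {L : MvPolynomial σ R} (hL : L.IsHomogeneous 1) :
    ∃ l, linearForm l = L := by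
  rw [← mem_homogeneousSubmodule, homogeneousSubmodule_one_eq_span_X] at hL
  exact (Submodule.mem_span_range_iff_exists_fun R).mp hL

theorem coeff_linearForm_pow (l : σ → R) (e : σ →₀ ℕ) (d : ℕ) :
    coeff e (linearForm l ^ d) =
      if e.degree = d then e.multinomial * eval l (monomial e 1) else 0 := by
  rw [linearForm, coeff_linearCombination_X_pow_of_fintype, eval_monomial, one_mul]
  rfl

end LinearForms

section Exponents

theorem degree_cons {n : ℕ} (k : ℕ) (b : Fin n →₀ ℕ) : (b.cons k).degree = k + b.degree := by
  simp [Finsupp.degree_eq_sum, Fin.sum_univ_succ]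

theorem cons_inf_cons {n : ℕ} (k : ℕ) (a b : Fin n →₀ ℕ) :
    a.cons k ⊓ b.cons k = (a ⊓ b).cons k := by
  ext j
  cases j using Fin.cases <;> simp

theorem monomial_cons {R : Type*} [CommSemiring R] {n : ℕ} (k : ℕ) (b : Fin n →₀ ℕ) :
    monomial (b.cons k) (1 : R) = X 0 ^ k * ∏ i, X i.succ ^ b i := by
  rw [monomial_eq, Finsupp.prod_fintype _ _ fun _ => pow_zero _, Fin.prod_univ_succ]
  simp

theorem totalDegree_monomial_one {R σ : Type*} [CommSemiring R] [Nontrivial R] (e : σ →₀ ℕ) :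
    (monomial e (1 : R)).totalDegree = e.degree :=
  totalDegree_monomial e one_ne_zero

theorem degree_le_totalDegree {R σ : Type*} [CommSemiring R] {g : MvPolynomial σ R} {e : σ →₀ ℕ}
    (he : e ∈ g.support) : e.degree ≤ g.totalDegree :=
  le_totalDegree he

theorem cast_multinomial_ne_zero {K σ : Type*} [AddMonoidWithOne K] [CharZero K] (e : σ →₀ ℕ) :
    (e.multinomial : K) ≠ 0 :=
  Nat.cast_ne_zero.mpr (Finsupp.multinomial_eq e ▸ (Nat.multinomial_pos _ _).ne')

theorem exists_ne_and_le_add_of_add_degree_eq {σ : Type*} {a b : σ →₀ ℕ} {c k : ℕ}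
    (hdeg : k + b.degree = c + a.degree) (hab : b ≠ a) : ∃ i, b i ≠ a i ∧ b i ≤ a i + c := by
  by_contra! hgap
  have hle : a ≤ b := fun i => by
    by_cases hi : b i = a i
    · exact hi.ge
    · exact (Nat.le_add_right _ _).trans (hgap i hi).le
  obtain ⟨s, rfl⟩ := exists_add_of_le hle
  obtain ⟨i, hi⟩ := Finsupp.ne_iff.mp hab
  have hsi := hgap i hi
  have hs := Finsupp.le_degree i s
  rw [map_add] at hdeg
  rw [Finsupp.add_apply] at hsi
  omega

theorem exists_eq_monomial_inf_of_dvd_iff {R σ : Type*} [CommRing R] [IsDomain R] {e f : σ →₀ ℕ}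
    {G : MvPolynomial σ R}
    (hG : ∀ D : MvPolynomial σ R, D ∣ G ↔ D ∣ monomial e 1 ∧ D ∣ monomial f 1) :
    ∃ u : Rˣ, G = monomial (e ⊓ f) (u : R) := by
  obtain ⟨hGe, hGf⟩ := (hG G).mp dvd_rfl
  obtain ⟨g, _, hge, ⟨u, rfl⟩, rfl⟩ := dvd_monomial_one_iff_exists.mp hGe
  have hgf : g ≤ f := (monomial_dvd_monomial.mp hGf).1.resolve_left one_ne_zero
  have hinf : monomial (e ⊓ f) (1 : R) ∣ monomial g (u : R) := (hG _).mpr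
    ⟨monomial_one_dvd_monomial_one.mpr inf_le_left, monomial_one_dvd_monomial_one.mpr inf_le_right⟩
  have hle : e ⊓ f ≤ g := (monomial_dvd_monomial.mp hinf).1.resolve_left u.ne_zero
  exact ⟨u, by rw [le_antisymm (le_inf hge hgf) hle]⟩

end Exponents

section LowerBound

variable {K : Type*} [Field K]

theorem exists_ne_zero_mem_restrictSupport_eval_eq_zero {σ ι : Type*} [Fintype ι]
    (s : Finset (σ →₀ ℕ)) (p : ι → σ → K) (hs : Fintype.card ι < s.card) :
    ∃ g ∈ restrictSupport K (s : Set (σ →₀ ℕ)), g ≠ 0 ∧ ∀ j, eval (p j) g = 0 := by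
  let B := basisRestrictSupport K (s : Set (σ →₀ ℕ))
  have := Module.Finite.of_basis B
  let evalAt : restrictSupport K (s : Set (σ →₀ ℕ)) →ₗ[K] ι → K :=
    LinearMap.pi fun j => (aeval (p j)).toLinearMap ∘ₗ Submodule.subtype _
  have hker : LinearMap.ker evalAt ≠ ⊥ := by
    apply LinearMap.ker_ne_bot_of_finrank_lt
    rw [Module.finrank_fintype_fun_eq_card, Module.finrank_eq_card_basis B]
    simpa using hs
  obtain ⟨g, hg, hg0⟩ := Submodule.exists_mem_ne_zero_of_ne_bot hker
  exact ⟨g, g.2, by simpa using hg0, fun j => congrFun hg j⟩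

/-- The homogenization of `g`, in degree `g.totalDegree`, by a new variable placed first. It turns
polynomials vanishing at affine points into forms vanishing at the corresponding linear forms. -/
noncomputable def homogenization {R : Type*} [CommSemiring R] {n : ℕ}
    (g : MvPolynomial (Fin n) R) : MvPolynomial (Fin (n + 1)) R :=
  ∑ β ∈ g.support, monomial (β.cons (g.totalDegree - β.degree)) (coeff β g)

theorem isHomogeneous_homogenization {R : Type*} [CommSemiring R] {n : ℕ}
    (g : MvPolynomial (Fin n) R) : (homogenization g).IsHomogeneous g.totalDegree :=
  IsHomogeneous.sum _ _ _ fun β hβ => isHomogeneous_monomial _ <| by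
    rw [degree_cons, Nat.sub_add_cancel (degree_le_totalDegree hβ)]

theorem coeff_cons_zero_homogenization {R : Type*} [CommSemiring R] {n : ℕ}
    {g : MvPolynomial (Fin n) R} {β : Fin n →₀ ℕ} (hβ : β.degree = g.totalDegree) :
    coeff (β.cons 0) (homogenization g) = coeff β g := by
  classical
  simp only [homogenization, coeff_sum, coeff_monomial, Finsupp.cons_injective2.eq_iff]
  rw [Finset.sum_eq_single β]
  · simp [hβ]
  · rintro γ - hγ
    simp [hγ]
  · simp +contextual

theorem eval_homogenization {n : ℕ} (g : MvPolynomial (Fin n) K) {l : Fin (n + 1) → K}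
    (hl : l 0 ≠ 0) :
    eval l (homogenization g) = l 0 ^ g.totalDegree * eval (fun i => l i.succ / l 0) g := by
  rw [homogenization, map_sum, eval_eq', Finset.mul_sum]
  refine Finset.sum_congr rfl fun β hβ => ?_
  have hprod : ∏ i, (l i.succ / l 0) ^ β i = (∏ i, l i.succ ^ β i) / l 0 ^ β.degree := by
    simp only [div_pow, Finset.prod_div_distrib, Finset.prod_pow_eq_pow_sum,
      Finsupp.degree_eq_sum]
  rw [eval_monomial, Finsupp.prod_fintype _ _ fun _ => pow_zero _, Fin.prod_univ_succ,
    Finsupp.cons_zero, hprod, pow_sub₀ _ hl (degree_le_totalDegree hβ)]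
  simp only [Finsupp.cons_succ]
  ring

theorem exists_isHomogeneous_coeff_cons_ne_zero_eval_eq_zero {ι : Type*} [Fintype ι] {n c : ℕ}
    (hc : c ≠ 0) {a : Fin n →₀ ℕ} (l : ι → Fin (n + 1) → K)
    (hι : Fintype.card ι < ∏ i, (a i + 1)) :
    ∃ G : MvPolynomial (Fin (n + 1)) K, G.IsHomogeneous (a.cons c).degree ∧
      coeff (a.cons c) G ≠ 0 ∧ ∀ j, eval (l j) G = 0 := by
  have hbox : (Finset.Iic a).card = ∏ i, (a i + 1) := by
    rw [Finsupp.card_Iic, Finset.prod_subset (Finset.subset_univ _) fun i _ hi => by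
      simp [Finsupp.notMem_support_iff.mp hi]]
    simp
  obtain ⟨g, hga, hg, heval⟩ := exists_ne_zero_mem_restrictSupport_eval_eq_zero
    (Finset.Iic a) (fun j i => l j i.succ / l j 0) (hbox ▸ hι)
  obtain ⟨β, hβ, hβdeg⟩ := Finset.exists_mem_eq_sup g.support (support_nonempty.mpr hg)
    Finsupp.degree
  replace hβdeg : β.degree = g.totalDegree := hβdeg.symm
  obtain ⟨γ, rfl⟩ := exists_add_of_le (Finset.mem_Iic.mp (hga hβ))
  have hcons : (β + γ).cons c = γ.cons c + β.cons 0 := by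
    ext j
    cases j using Fin.cases <;> simp [add_comm]
  refine ⟨monomial (γ.cons c) 1 * homogenization g, ?_, ?_, fun j => ?_⟩
  · rw [hcons, map_add, degree_cons 0, zero_add, hβdeg]
    exact (isHomogeneous_monomial 1 rfl).mul (isHomogeneous_homogenization g)
  · rw [hcons, coeff_monomial_mul, one_mul, coeff_cons_zero_homogenization hβdeg]
    exact mem_support_iff.mp hβ
  · rw [map_mul]
    by_cases hl : l j 0 = 0
    · simp [monomial_cons, hl, hc]
    · rw [eval_homogenization g hl, heval, mul_zero, mul_zero]

variable [CharZero K] {ι : Type*} [Fintype ι]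

/-- Both sides are the apolarity pairing of `G` with `∑ⱼ λⱼ Lⱼᵈ`. -/
theorem sum_mul_eval_eq_sum_coeff_mul_coeff_div_multinomial {σ : Type*} [Fintype σ] {d : ℕ}
    (lam : ι → K) (l : ι → σ → K) {G : MvPolynomial σ K} (hG : G.IsHomogeneous d) :
    ∑ j, lam j * eval (l j) G = ∑ e ∈ G.support,
      coeff e G * (coeff e (∑ j, C (lam j) * linearForm (l j) ^ d) / e.multinomial) := by
  simp only [eval_eq (l _) G, Finset.mul_sum]
  rw [Finset.sum_comm]
  refine Finset.sum_congr rfl fun e he => ?_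
  have hdeg : e.degree = d := by
    by_contra hne
    exact mem_support_iff.mp he (hG.coeff_eq_zero hne)
  simp only [coeff_sum, coeff_C_mul, coeff_linearForm_pow, if_pos hdeg, eval_monomial, one_mul,
    Finset.sum_div, Finset.mul_sum]
  refine Finset.sum_congr rfl fun j _ => ?_
  have := cast_multinomial_ne_zero (K := K) e
  rw [Finsupp.prod]
  field_simp

theorem prod_add_one_le_card_of_sum_linearForm_pow_eq_monomial {n c : ℕ} (hc : c ≠ 0)
    {a : Fin n →₀ ℕ} {lam : ι → K} {l : ι → Fin (n + 1) → K}
    (h : ∑ j, C (lam j) * linearForm (l j) ^ (a.cons c).degree = monomial (a.cons c) 1) :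
    ∏ i, (a i + 1) ≤ Fintype.card ι := by
  classical
  by_contra! hι
  obtain ⟨G, hG, hcoeff, heval⟩ := exists_isHomogeneous_coeff_cons_ne_zero_eval_eq_zero hc l hι
  have hpair := sum_mul_eval_eq_sum_coeff_mul_coeff_div_multinomial lam l hG
  rw [h, Finset.sum_eq_single (a.cons c) (fun e _ he => by simp [coeff_monomial, he.symm])
    (fun hα => by simp [notMem_support_iff.mp hα])] at hpair
  simp [heval, hcoeff, cast_multinomial_ne_zero (K := K) (a.cons c)] at hpair

end LowerBound

theorem prod_add_one_le_waringRank_monomial {n c : ℕ} (hc : c ≠ 0) (a : Fin n →₀ ℕ) :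
    ∏ i, (a i + 1) ≤ waringRank (monomial (a.cons c) (1 : ℂ)) := by
  obtain ⟨lam, L, hL, h⟩ : HasWaringDecomposition _ (waringRank (monomial (a.cons c) (1 : ℂ))) :=
    Nat.sInf_mem (hasWaringDecomposition_of_isHomogeneous _ (isHomogeneous_monomial 1 rfl))
  choose l hl using fun j => exists_linearForm_eq (hL j)
  simp only [← hl, totalDegree_monomial_one] at h
  simpa using prod_add_one_le_card_of_sum_linearForm_pow_eq_monomial hc h.symm

section GapSets

variable {K : Type*} [Field K]

/-- A set of `a + 1` numbers on which `z ^ (a + 1)` agrees with a polynomial of degree at most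
`a - c`; equivalently, `∏ z ∈ Z, (X - z)` has no terms of degree `a - c + 1, …, a`. Grids of such
sets carry the decompositions of monomials. The degree bound is written without subtraction, so it
forces `c ≤ a`. -/
def IsGapSet (c a : ℕ) (Z : Finset K) : Prop :=
  Z.card = a + 1 ∧ ∃ q : Polynomial K, q.natDegree + c ≤ a ∧ ∀ z ∈ Z, z ^ (a + 1) = q.eval z

theorem sum_nodalWeight_mul_eval [DecidableEq K] {Z : Finset K} {a : ℕ} (hZ : Z.card = a + 1)
    {P : Polynomial K} (hP : P.natDegree ≤ a) :
    ∑ z ∈ Z, Lagrange.nodalWeight Z id z * P.eval z = P.coeff a := by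
  have hdeg : P.degree < Z.card := Polynomial.degree_le_natDegree.trans_lt <| by
    rw [hZ]
    exact_mod_cast Nat.lt_succ_of_le hP
  have h := Lagrange.coeff_eq_sum (v := id) Function.injective_id.injOn hdeg
  rw [hZ, Nat.add_sub_cancel] at h
  simp only [h, Lagrange.nodalWeight, Finset.prod_inv_distrib, div_eq_inv_mul, id]

theorem IsGapSet.sum_nodalWeight_mul_pow [DecidableEq K] {c a k : ℕ} {Z : Finset K}
    (hZ : IsGapSet c a Z) (hk : k ≤ a + c) :
    ∑ z ∈ Z, Lagrange.nodalWeight Z id z * z ^ k = if k = a then 1 else 0 := by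
  obtain ⟨hcard, q, hq, hroot⟩ := hZ
  rcases le_or_gt k a with hka | hak
  · have h := sum_nodalWeight_mul_eval hcard (P := Polynomial.X ^ k) (by simpa using hka)
    simpa [Polynomial.coeff_X_pow, eq_comm] using h
  · obtain ⟨s, rfl⟩ := Nat.exists_eq_add_of_le hak
    have hdeg : (q * Polynomial.X ^ s).natDegree < a := by
      have := Polynomial.natDegree_mul_le (p := q) (q := Polynomial.X ^ s)
      rw [Polynomial.natDegree_X_pow] at this
      omega
    rw [if_neg hak.ne', ← Polynomial.coeff_eq_zero_of_natDegree_lt hdeg,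
      ← sum_nodalWeight_mul_eval hcard hdeg.le]
    refine Finset.sum_congr rfl fun z hz => ?_
    rw [Nat.succ_eq_add_one, pow_add, hroot z hz]
    simp

theorem card_piFinset_of_isGapSet {σ : Type*} [Fintype σ] [DecidableEq σ] {c : ℕ} {a : σ → ℕ}
    {Z : σ → Finset K} (hZ : ∀ i, IsGapSet c (a i) (Z i)) :
    (Fintype.piFinset Z).card = ∏ i, (a i + 1) := by
  rw [Fintype.card_piFinset]
  exact Finset.prod_congr rfl fun i _ => (hZ i).1

end GapSets

section ConstructionOfGapSets

open Polynomial (nthRootsFinset mem_nthRootsFinset)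

variable {K : Type*} [Field K] [CharZero K] {c a k : ℕ}

theorem disjoint_nthRootsFinset_one_two (hk : k ≠ 0) :
    Disjoint (nthRootsFinset (a + 1) (1 : K)) (nthRootsFinset k 2) := by
  refine Finset.disjoint_left.mpr fun z hz₁ hz₂ => ?_
  rw [mem_nthRootsFinset a.succ_pos] at hz₁
  rw [mem_nthRootsFinset (Nat.pos_of_ne_zero hk)] at hz₂
  have htwo : (2 : K) ^ (a + 1) = 1 := by
    rw [← hz₂, pow_right_comm, hz₁, one_pow]
  norm_cast at htwo
  exact (Nat.one_lt_two_pow a.succ_ne_zero).ne' htwo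

variable [IsAlgClosed K]

theorem card_nthRootsFinset (hk : k ≠ 0) {t : K} (ht : t ≠ 0) :
    (nthRootsFinset k t).card = k := by
  classical
  have : NeZero k := ⟨hk⟩
  obtain ⟨ζ, hζ⟩ := HasEnoughRootsOfUnity.exists_primitiveRoot K k
  rw [nthRootsFinset, Multiset.toFinset_card_of_nodup (hζ.nthRoots_nodup ht), hζ.card_nthRoots,
    if_pos (IsAlgClosed.exists_pow_nat_eq t (Nat.pos_of_ne_zero hk))]

theorem isGapSet_nthRootsFinset_one (hca : c ≤ a) :
    IsGapSet c a (nthRootsFinset (a + 1) (1 : K)) :=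
  ⟨card_nthRootsFinset a.succ_ne_zero one_ne_zero, 1, by simpa using hca, fun z hz => by
    simpa using (mem_nthRootsFinset a.succ_pos 1).mp hz⟩

theorem isGapSet_insert_zero_nthRootsFinset_one [DecidableEq K] (hca : c ≤ a) :
    IsGapSet c (a + 1) (insert 0 (nthRootsFinset (a + 1) (1 : K))) := by
  refine ⟨?_, Polynomial.X, ?_, fun z hz => ?_⟩
  · rw [Finset.card_insert_of_notMem, card_nthRootsFinset a.succ_ne_zero one_ne_zero]
    simp [mem_nthRootsFinset a.succ_pos]
  · rw [Polynomial.natDegree_X]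
    omega
  · rcases Finset.mem_insert.mp hz with rfl | hz
    · simp
    · rw [pow_succ, (mem_nthRootsFinset a.succ_pos 1).mp hz, one_mul, Polynomial.eval_X]

theorem isGapSet_nthRootsFinset_one_union_two [DecidableEq K] (hca : c ≤ a) (hck : c < k) :
    IsGapSet c (a + k) (nthRootsFinset (a + 1) (1 : K) ∪ nthRootsFinset k 2) := by
  have hk : k ≠ 0 := Nat.ne_zero_of_lt hck
  -- `q = X ^ (a + k + 1) - (X ^ (a + 1) - 1) * (X ^ k - 2)`
  let q : Polynomial K := 2 * Polynomial.X ^ (a + 1) + Polynomial.X ^ k - 2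
  refine ⟨?_, q, ?_, fun z hz => ?_⟩
  · rw [Finset.card_union_of_disjoint (disjoint_nthRootsFinset_one_two hk),
      card_nthRootsFinset a.succ_ne_zero one_ne_zero, card_nthRootsFinset hk two_ne_zero]
    omega
  · have hdeg : q.natDegree ≤ max (a + 1) k := by
      unfold q
      compute_degree!
    omega
  · have hroot : (z ^ (a + 1) - 1) * (z ^ k - 2) = 0 := by
      rcases Finset.mem_union.mp hz with hz | hz
      · rw [(mem_nthRootsFinset a.succ_pos 1).mp hz, sub_self, zero_mul]
      · rw [(mem_nthRootsFinset (Nat.pos_of_ne_zero hk) 2).mp hz, sub_self, mul_zero]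
    simp only [q, Polynomial.eval_sub, Polynomial.eval_add, Polynomial.eval_mul,
      Polynomial.eval_pow, Polynomial.eval_X, Polynomial.eval_ofNat]
    linear_combination hroot

variable (K) in
theorem exists_isGapSet_subset_isGapSet {b : ℕ} (hca : c ≤ a)
    (hab : b = a ∨ b = a + 1 ∨ a + c + 1 ≤ b) :
    ∃ Z W : Finset K, IsGapSet c a Z ∧ IsGapSet c b W ∧ Z ⊆ W := by
  classical
  have hZ := isGapSet_nthRootsFinset_one (K := K) hca
  rcases hab with rfl | rfl | hab
  · exact ⟨_, _, hZ, hZ, subset_rfl⟩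
  · exact ⟨_, _, hZ, isGapSet_insert_zero_nthRootsFinset_one hca, Finset.subset_insert _ _⟩
  · obtain ⟨k, rfl⟩ := Nat.exists_eq_add_of_le (show a ≤ b by omega)
    exact ⟨_, _, hZ, isGapSet_nthRootsFinset_one_union_two hca (by omega),
      Finset.subset_union_left⟩

variable (K) in
theorem exists_isGapSet_inter [DecidableEq K] {b : ℕ} (hca : c ≤ a) (hcb : c ≤ b)
    (hab : |(a : ℤ) - b| = 0 ∨ |(a : ℤ) - b| = 1 ∨ (c : ℤ) + 1 ≤ |(a : ℤ) - b|) :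
    ∃ Z W : Finset K, IsGapSet c a Z ∧ IsGapSet c b W ∧ IsGapSet c (a ⊓ b) (Z ∩ W) := by
  wlog h : a ≤ b generalizing a b
  · obtain ⟨W, Z, hW, hZ, hWZ⟩ :=
      this hcb hca (by rwa [abs_sub_comm]) (le_of_not_ge h)
    exact ⟨Z, W, hZ, hW, by rwa [inf_comm, Finset.inter_comm]⟩
  obtain ⟨Z, W, hZ, hW, hZW⟩ := exists_isGapSet_subset_isGapSet K hca (b := b) (by
    rw [abs_sub_comm, abs_of_nonneg (by omega)] at hab
    omega)
  exact ⟨Z, W, hZ, hW, by rwa [inf_eq_left.mpr h, Finset.inter_eq_left.mpr hZW]⟩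

end ConstructionOfGapSets

section UpperBound

/-- The linear form `x₀ + p₁x₁ + ⋯ + pₙxₙ` of the point `p` of the affine chart `x₀ = 1`. -/
noncomputable def affineForm {R : Type*} [CommSemiring R] {n : ℕ} (p : Fin n → R) :
    MvPolynomial (Fin (n + 1)) R :=
  linearForm (Fin.cons 1 p : Fin (n + 1) → R)

theorem isHomogeneous_affineForm {R : Type*} [CommSemiring R] {n : ℕ} (p : Fin n → R) :
    (affineForm p).IsHomogeneous 1 :=
  isHomogeneous_linearForm _

theorem coeff_cons_affineForm_pow {R : Type*} [CommSemiring R] {n : ℕ} (p : Fin n → R)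
    (b : Fin n →₀ ℕ) (k d : ℕ) :
    coeff (b.cons k) (affineForm p ^ d) =
      if k + b.degree = d then (b.cons k).multinomial * ∏ i, p i ^ b i else 0 := by
  rw [affineForm, coeff_linearForm_pow, degree_cons, monomial_cons]
  simp

theorem sum_nodalWeight_smul_affineForm_pow {K : Type*} [Field K] [DecidableEq K] {n c : ℕ}
    {a : Fin n →₀ ℕ} {Z : Fin n → Finset K} (hZ : ∀ i, IsGapSet c (a i) (Z i)) :
    ∑ p ∈ Fintype.piFinset Z,
        (∏ i, Lagrange.nodalWeight (Z i) id (p i)) • affineForm p ^ (a.cons c).degree =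
      monomial (a.cons c) ((a.cons c).multinomial : K) := by
  ext e
  obtain ⟨k, b, rfl⟩ : ∃ (k : ℕ) (b : Fin n →₀ ℕ), b.cons k = e := ⟨_, _, e.cons_tail⟩
  simp only [coeff_sum, coeff_smul, smul_eq_mul, coeff_cons_affineForm_pow, coeff_monomial,
    degree_cons, Finsupp.cons_injective2.eq_iff]
  by_cases hdeg : k + b.degree = c + a.degree
  · simp only [if_pos hdeg, mul_left_comm _ ((b.cons k).multinomial : K), ← Finset.mul_sum,
      ← Finset.prod_mul_distrib]
    rw [← Finset.prod_univ_sum Z fun i z => Lagrange.nodalWeight (Z i) id z * z ^ b i]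
    by_cases hba : b = a
    · subst hba
      obtain rfl : k = c := Nat.add_right_cancel hdeg
      rw [Finset.prod_eq_one fun i _ => by simp [(hZ i).sum_nodalWeight_mul_pow]]
      simp
    · obtain ⟨i, hne, hle⟩ := exists_ne_and_le_add_of_add_degree_eq hdeg hba
      rw [Finset.prod_eq_zero (Finset.mem_univ i) (by
        rw [(hZ i).sum_nodalWeight_mul_pow hle, if_neg hne])]
      simp [Ne.symm hba]
  · have hne : ¬(c = k ∧ a = b) := by
      rintro ⟨rfl, rfl⟩
      exact hdeg rfl
    simp [hdeg, hne]

theorem monomial_cons_mem_span_affineForm_pow {K : Type*} [Field K] [CharZero K] {n c d : ℕ}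
    {a : Fin n →₀ ℕ} {Z : Fin n → Finset K} (hZ : ∀ i, IsGapSet c (a i) (Z i))
    (hd : (a.cons c).degree = d) (u : K) :
    monomial (a.cons c) u ∈ Submodule.span K
      ((fun p => affineForm p ^ d) '' (Fintype.piFinset Z : Set (Fin n → K))) := by
  classical
  subst hd
  have hu : monomial (a.cons c) u =
      (u / (a.cons c).multinomial) • monomial (a.cons c) ((a.cons c).multinomial : K) := by
    rw [smul_monomial, smul_eq_mul, div_mul_cancel₀ _ (cast_multinomial_ne_zero _)]
  rw [hu, ← sum_nodalWeight_smul_affineForm_pow hZ]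
  exact Submodule.smul_mem _ _ <| Submodule.sum_mem _ fun p hp =>
    Submodule.smul_mem _ _ <| Submodule.subset_span ⟨p, hp, rfl⟩

variable {m d e : ℕ} {ι : Type*} {L : ι → MvPolynomial (Fin m) ℂ}

theorem waringRank_le_card_of_mem_span (hL : ∀ p, (L p).IsHomogeneous 1) {T : Finset ι}
    {F : MvPolynomial (Fin m) ℂ} (hF : F ∈ Submodule.span ℂ ((fun p => L p ^ d) '' T)) :
    waringRank F ≤ T.card := by
  rcases eq_or_ne F 0 with rfl | hF0
  · have hzero : HasWaringDecomposition (0 : MvPolynomial (Fin m) ℂ) 0 :=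
      ⟨Fin.elim0, Fin.elim0, fun j => j.elim0, by simp⟩
    exact (Nat.sInf_le hzero).trans (Nat.zero_le _)
  have hle : Submodule.span ℂ ((fun p => L p ^ d) '' T) ≤ homogeneousSubmodule (Fin m) ℂ d := by
    rw [Submodule.span_le]
    rintro _ ⟨p, -, rfl⟩
    simpa using (hL p).pow d
  have hdeg : F.totalDegree = d := IsHomogeneous.totalDegree (hle hF) hF0
  obtain ⟨w, hw⟩ := (Submodule.mem_span_image_finset_iff_exists_fun' ℂ).mp hF
  refine Nat.sInf_le ⟨fun j => w (T.equivFin.symm j), fun j => L (T.equivFin.symm j),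
    fun j => hL _, ?_⟩
  rw [hdeg, ← hw, ← Finset.sum_coe_sort, ← T.equivFin.symm.sum_comp]
  simp only [smul_eq_C_mul]

theorem waringRank_add_add_waringRank_le_card_add_card [DecidableEq ι]
    (hL : ∀ p, (L p).IsHomogeneous 1) {S T : Finset ι} {F G H : MvPolynomial (Fin m) ℂ}
    (hF : F ∈ Submodule.span ℂ ((fun p => L p ^ d) '' S))
    (hG : G ∈ Submodule.span ℂ ((fun p => L p ^ d) '' T))
    (hH : H ∈ Submodule.span ℂ ((fun p => L p ^ e) '' ((S ∩ T : Finset ι) : Set ι))) :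
    waringRank (F + G) + waringRank H ≤ S.card + T.card := by
  rw [← Finset.card_union_add_card_inter]
  have hFG : F + G ∈ Submodule.span ℂ ((fun p => L p ^ d) '' ((S ∪ T : Finset ι) : Set ι)) := by
    rw [Finset.coe_union, Set.image_union, Submodule.span_union]
    exact Submodule.add_mem_sup hF hG
  exact add_le_add (waringRank_le_card_of_mem_span hL hFG) (waringRank_le_card_of_mem_span hL hH)

end UpperBound

theorem mainTheorem11 (n c : ℕ) (a b : Fin n → ℕ)
    (hc : 1 ≤ c) (ha : ∀ i, c ≤ a i) (hb : ∀ i, c ≤ b i)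
    (hab : ∀ i, |(a i : ℤ) - b i| = 0 ∨ |(a i : ℤ) - b i| = 1 ∨ (c : ℤ) + 1 ≤ |(a i : ℤ) - b i|)
    (M₁ M₂ M₁₂ : MvPolynomial (Fin (n + 1)) ℂ)
    (hM₁ : M₁ = X 0 ^ c * ∏ i : Fin n, X i.succ ^ a i)
    (hM₂ : M₂ = X 0 ^ c * ∏ i : Fin n, X i.succ ^ b i)
    (hdeg : M₁.totalDegree = M₂.totalDegree)
    (hgcd : ∀ D : MvPolynomial (Fin (n + 1)) ℂ, D ∣ M₁₂ ↔ D ∣ M₁ ∧ D ∣ M₂) :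
    (waringRank (M₁ + M₂) : ℤ) ≤ waringRank M₁ + waringRank M₂ - waringRank M₁₂ := by
  classical
  lift a to Fin n →₀ ℕ using Set.toFinite _
  lift b to Fin n →₀ ℕ using Set.toFinite _
  rw [← monomial_cons] at hM₁ hM₂
  subst hM₁ hM₂
  have hdeg' : (b.cons c).degree = (a.cons c).degree := by
    simpa only [totalDegree_monomial_one] using hdeg.symm
  obtain ⟨u, rfl⟩ := exists_eq_monomial_inf_of_dvd_iff hgcd
  rw [cons_inf_cons]
  choose Z W hZ hW hZW using fun i => exists_isGapSet_inter ℂ (ha i) (hb i) (hab i)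
  have hinter := monomial_cons_mem_span_affineForm_pow (a := a ⊓ b) hZW rfl (u : ℂ)
  rw [Fintype.piFinset_inter] at hinter
  have hupper := waringRank_add_add_waringRank_le_card_add_card
    isHomogeneous_affineForm
    (monomial_cons_mem_span_affineForm_pow hZ rfl 1)
    (monomial_cons_mem_span_affineForm_pow hW hdeg' 1) hinter
  rw [card_piFinset_of_isGapSet hZ, card_piFinset_of_isGapSet hW] at hupper
  have hlower₁ := prod_add_one_le_waringRank_monomial (Nat.one_le_iff_ne_zero.mp hc) a
  have hlower₂ := prod_add_one_le_waringRank_monomial (Nat.one_le_iff_ne_zero.mp hc) b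
  omega
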